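/- A finite permutational automaton over a finite alphabet $X$ consists of a finite non-empty set $Q$ of states, a transition function $\lambda : Q\times X\to Q$ and an output function $\mu : Q\times X\to X$ such that $\mu_q=\mu(q,\cdot)$ is a permutation of $X$ for every $q\in Q$. Each $\mu_q$ extends to a permutation of the set $X^*$ of finite words by $\mu_q(\Lambda)=\Lambda$ for the empty word $\Lambda$ and $\mu_q(xw)=\mu_q(x)\,\mu_{\lambda(q,x)}(w)$ for $x\in X$, $w\in X^*$. For a prime $p$, the automaton is a $p$-automaton if $|X|=p$ and all the permutations $\mu_q$ of $X$, $q\in Q$, are powers of one fixed cycle of length $p$ on $X$. A group is generated by a finite $p$-automaton if it is isomorphic to the group of permutations of $X^*$ generated by $\{\mu_q : q\in S\}$ for some finite $p$-automaton and some set $S\subseteq Q$ of its states. A group $G$ is residually $p$-finite if for every $g\in G$ with $g\ne 1$ there is a normal subgroup $K$ of $G$ with $g\notin K$ such that $G/K$ is a finite $p$-group. **Theorem.** Let $p$ be a prime, let $r=p^k$ for some $k\ge 1$, and let $M=(m_{ij})$ be an integer $r\times r$ matrix of the form $M=pN+C$, where $N$ is an integer $r\times r$ matrix and $C$ is the permutation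 matrix of a permutation of $\{1,\dots,r\}$ of order $p^m$ for some $m\ge 0$. Let $$\mathbb{G}_M=\langle a_1,\dots,a_r,t \mid a_ia_j=a_ja_i\ (1\le i<j\le r),\ t^{-1}a_it=a_1^{m_{i1}}\cdots a_r^{m_{ir}}\ (1\le i\le r)\rangle,$$ an ascending HNN extension of the free abelian group $A_r$ with basis $a_1,\dots,a_r$. Then 1. the group $\mathbb{G}_M$ is generated by a finite $p$-automaton; 2. the group $\mathbb{G}_M$ is residually $p$-finite. -/

import Mathlib

/-- A permutational automaton with set of states `Q` over the alphabet `X`: a transition function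
`Q × X → Q` and an output function `Q × X → X` whose restriction to every state is a
permutation of `X`. -/
structure PermAutomaton (Q X : Type*) where
  /-- the transition function -/
  next : Q → X → Q
  /-- the output function; `out q` is the permutation of `X` defined at the state `q` -/
  out : Q → Equiv.Perm X

namespace PermAutomaton

variable {Q X : Type*}

/-- The action of the state `q` on finite words: the empty word is fixed, and a word `x w` is sent
to the letter `out q x` followed by the image of `w` under the state `next q x`. -/
def act (A : PermAutomaton Q X) : Q → List X → List X
  | _, [] => []
  | q, x :: w => A.out q x :: A.act (A.next q x) w

/-- The inverse of `act`. -/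
def actInv (A : PermAutomaton Q X) : Q → List X → List X
  | _, [] => []
  | q, y :: w => (A.out q).symm y :: A.actInv (A.next q ((A.out q).symm y)) w

theorem actInv_act (A : PermAutomaton Q X) (q : Q) (w : List X) :
    A.actInv q (A.act q w) = w := by
  induction w generalizing q with
  | nil => rfl
  | cons x w ih => simp [act, actInv, ih]

theorem act_actInv (A : PermAutomaton Q X) (q : Q) (w : List X) :
    A.act q (A.actInv q w) = w := by
  induction w generalizing q with
  | nil => rfl
  | cons x w ih => simp [act, actInv, ih]

/-- The automaton permutation of the set of finite words defined at the state `q`. -/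
def wordPerm (A : PermAutomaton Q X) (q : Q) : Equiv.Perm (List X) where
  toFun := A.act q
  invFun := A.actInv q
  left_inv := A.actInv_act q
  right_inv := A.act_actInv q

/-- The group generated by the automaton permutations defined at the states in `S`. -/
def groupOf (A : PermAutomaton Q X) (S : Set Q) : Subgroup (Equiv.Perm (List X)) :=
  Subgroup.closure (A.wordPerm '' S)

/-- `A` is a `p`-automaton: the alphabet has `p` letters, and the permutations at all states are
powers of one fixed cycle of length `p` (the length of a cycle is its order). -/
def IsPAutomaton (p : ℕ) (A : PermAutomaton Q X) : Prop :=
  Nat.card X = p ∧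
    ∃ c : Equiv.Perm X, c.IsCycle ∧ orderOf c = p ∧ ∀ q : Q, A.out q ∈ Subgroup.zpowers c

end PermAutomaton

/-- The group `G` is generated by a finite `p`-automaton: there is a `p`-automaton with a finite
non-empty set of states such that `G` is isomorphic to the group generated by a subset of the
automaton permutations defined at its states. -/
def IsGeneratedByFinitePAutomaton (p : ℕ) (G : Type*) [Group G] : Prop :=
  ∃ (Q X : Type) (A : PermAutomaton Q X) (S : Set Q),
    Finite Q ∧ Nonempty Q ∧ A.IsPAutomaton p ∧ Nonempty (G ≃* A.groupOf S)

/-- `G` is residually `p`-finite: every non-trivial element survives in some quotient of `G` that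
is a finite `p`-group. -/
def IsResiduallyPFinite (p : ℕ) (G : Type*) [Group G] : Prop :=
  ∀ g : G, g ≠ 1 →
    ∃ N : Subgroup G, ∃ _ : N.Normal, g ∉ N ∧ Finite (G ⧸ N) ∧ IsPGroup p (G ⧸ N)

namespace HNNGroup

/-- The generator `a_i` in the free group on `a_1, …, a_r, t`. -/
def a {r : ℕ} (i : Fin r) : FreeGroup (Fin r ⊕ Unit) := FreeGroup.of (Sum.inl i)

/-- The generator `t` in the free group on `a_1, …, a_r, t`. -/
def t {r : ℕ} : FreeGroup (Fin r ⊕ Unit) := FreeGroup.of (Sum.inr ())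

/-- The relators of the group: the commutators of the `a_i`, and those which express that
`t⁻¹ a_i t = a_1 ^ M_{i1} ⋯ a_r ^ M_{ir}` for all `i`. -/
def relators {r : ℕ} (M : Matrix (Fin r) (Fin r) ℤ) : Set (FreeGroup (Fin r ⊕ Unit)) :=
  {w | ∃ i j : Fin r, w = a i * a j * (a i)⁻¹ * (a j)⁻¹} ∪
  {w | ∃ i : Fin r,
    w = (t⁻¹ * a i * t) * (((List.finRange r).map fun j => a j ^ M i j).prod)⁻¹}

end HNNGroup

/-- The group `⟨a_1, …, a_r, t ∣ a_i a_j = a_j a_i, t⁻¹ a_i t = a_1 ^ M_{i1} ⋯ a_r ^ M_{ir}⟩`;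
for a non-degenerate `M` this is the ascending HNN extension of the free abelian group of rank `r`
by the injective endomorphism that `M` defines. -/
abbrev HNNGroup {r : ℕ} (M : Matrix (Fin r) (Fin r) ℤ) : Type :=
  PresentedGroup (HNNGroup.relators M)

/-!
The group `HNNGroup M` is made to act faithfully on the words over `ZMod p` by finite-state
permutations; both assertions follow from such an action.

*Residual finiteness.* A group generated by a `p`-automaton preserves the lengths and prefixes of
words and permutes the letters below every word by powers of one `p`-cycle. Hence it acts on the
words of each length `n` through a finite group of exponent dividing `p ^ n`
(`pow_apply_of_mem_treeAut`), and only the identity acts trivially on all of them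
(`IsGeneratedByFinitePAutomaton.isResiduallyPFinite`).

*The action when `M ≡ 1` modulo `p`.* Let `a_v` be the translation by `v ∈ ℤ ^ r` and `t⁻¹` the
linear map `y ↦ y M` of `ℤ_p ^ r`, and write a vector of `p`-adic integers as a word by interleaving
the digits of its coordinates. Modulo `p` an affine map `y ↦ y B + b` with `B ≡ 1` is a translation,
and on the higher digits it induces another affine map with the same linear part, whose translation
part stays bounded; so only finitely many states occur (`isFiniteState_affinePerm`). The linear map
alone need not have infinite order, so a first letter is added: below `0` the group acts as
described, and below the other letters `t⁻¹` acts as the translation of `ℤ_p` by one and the `a_v`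
act trivially (`isRealizable_one_add_smul`).

*Reduction to that case.* A power `M ^ (p ^ m)` is congruent to `1`, as `C ^ (p ^ m) = 1`. The group
of `M ^ p` is the subgroup of index `p` in the group of `M` that is generated by the `a_i` and
`t ^ p`; an action of the subgroup induces an action of the whole group, in which the first letter
records the coset, and `t` permutes the cosets by a `p`-cycle. This induction preserves
finite-stateness (`IsRealizable.of_pow`) and is repeated `m` times.

*Faithfulness.* Every element of the group is `t ^ i a_v t ^ (-j)` with `i, j ≥ 0`
(`HNNGroup.exists_normalForm`), so it suffices that `a_v t ^ n` acts non-trivially unless `v = 0`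
and `n = 0`.
-/

open scoped Matrix

/-! ### Finite-state permutations of words -/

namespace PermAutomaton

variable {Q Q' X : Type*}

/-- A morphism of automata preserves the permutations of words defined at the states. -/
theorem wordPerm_map (A : PermAutomaton Q X) (B : PermAutomaton Q' X) (f : Q → Q')
    (hout : ∀ q, B.out (f q) = A.out q) (hnext : ∀ q x, B.next (f q) x = f (A.next q x)) (q : Q) :
    B.wordPerm (f q) = A.wordPerm q := by
  ext1 w
  change B.act (f q) w = A.act q w
  induction w generalizing q with
  | nil => rfl
  | cons x w ih => simp [act, hout, hnext, ih]

end PermAutomaton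

/-- The permutation `g` of words is defined at a state of a finite automaton all of whose output
permutations are powers of `c`. -/
def IsFiniteState {X : Type} (c : Equiv.Perm X) (g : Equiv.Perm (List X)) : Prop :=
  ∃ (Q : Type) (_ : Finite Q) (A : PermAutomaton Q X) (q : Q),
    (∀ q, A.out q ∈ Subgroup.zpowers c) ∧ A.wordPerm q = g

/-- A state of an infinite automaton defines a finite-state permutation as soon as it lies in a
finite set of states closed under transitions. -/
theorem isFiniteState_of_closed {X Q : Type} {c : Equiv.Perm X} (A : PermAutomaton Q X) (T : Set Q)
    (hT : T.Finite) (hnext : ∀ q ∈ T, ∀ x, A.next q x ∈ T)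
    (hout : ∀ q, A.out q ∈ Subgroup.zpowers c) {q : Q} (hq : q ∈ T) :
    IsFiniteState c (A.wordPerm q) := by
  refine ⟨T, hT.to_subtype, ⟨fun q x => ⟨A.next q x, hnext q q.2 x⟩, fun q => A.out q⟩, ⟨q, hq⟩,
    fun q => hout q, ?_⟩
  exact (PermAutomaton.wordPerm_map _ A Subtype.val (fun _ => rfl) (fun _ _ => rfl) ⟨q, hq⟩).symm

theorem isFiniteState_one {X : Type} (c : Equiv.Perm X) : IsFiniteState c 1 := by
  refine ⟨Unit, inferInstance, ⟨fun _ _ => (), fun _ => 1⟩, (), fun _ => one_mem _, ?_⟩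
  ext1 w
  change PermAutomaton.act _ _ w = w
  induction w with
  | nil => rfl
  | cons x w ih => simp [PermAutomaton.act, ih]

/-- The permutation of words which acts by `π` on the first letter `x` and by `g x` on the
remaining word. -/
def wreath {X : Type} (π : Equiv.Perm X) (g : X → Equiv.Perm (List X)) :
    Equiv.Perm (List X) where
  toFun
    | [] => []
    | x :: w => π x :: g x w
  invFun
    | [] => []
    | x :: w => π.symm x :: (g (π.symm x)).symm w
  left_inv w := by cases w <;> simp
  right_inv w := by cases w <;> simp

section wreath

variable {X : Type}

theorem wreath_cons (π : Equiv.Perm X) (g : X → Equiv.Perm (List X)) (x : X) (w : List X) :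
    wreath π g (x :: w) = π x :: g x w := rfl

theorem wreath_mul (π π' : Equiv.Perm X) (g g' : X → Equiv.Perm (List X)) :
    wreath π g * wreath π' g' = wreath (π * π') (fun x => g (π' x) * g' x) := by
  ext1 w
  cases w <;> rfl

theorem wreath_one : wreath (1 : Equiv.Perm X) (fun _ => 1) = 1 := by
  ext1 w
  cases w <;> rfl

theorem eq_one_of_wreath_eq_one {π : Equiv.Perm X} {g : X → Equiv.Perm (List X)}
    (h : wreath π g = 1) : π = 1 ∧ ∀ x, g x = 1 := by
  have key : ∀ x w, π x :: g x w = x :: w := fun x w => by rw [← wreath_cons, h]; rfl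
  refine ⟨Equiv.ext fun x => ?_, fun x => Equiv.ext fun w => ?_⟩
  · exact (List.cons.inj (key x [])).1
  · exact (List.cons.inj (key x w)).2

/-- The permutations `wreath 1 g` form a copy of the product of the groups of the `g x`. -/
def wreathHom (X : Type) : (X → Equiv.Perm (List X)) →* Equiv.Perm (List X) where
  toFun := wreath 1
  map_one' := wreath_one
  map_mul' g g' := by rw [wreath_mul]; rfl

theorem isFiniteState_wreath [Finite X] {c π : Equiv.Perm X} {g : X → Equiv.Perm (List X)}
    (hπ : π ∈ Subgroup.zpowers c) (hg : ∀ x, IsFiniteState c (g x)) :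
    IsFiniteState c (wreath π g) := by
  choose Q hQ A q hout hq using hg
  let B : PermAutomaton (Option (Σ x, Q x)) X :=
    { next := fun s x => s.elim (some ⟨x, q x⟩) fun s => some ⟨s.1, (A s.1).next s.2 x⟩
      out := fun s => s.elim π fun s => (A s.1).out s.2 }
  have hB : ∀ x (s : Q x), B.wordPerm (some ⟨x, s⟩) = (A x).wordPerm s := fun x s =>
    PermAutomaton.wordPerm_map (A x) B (fun s => some ⟨x, s⟩) (fun _ => rfl) (fun _ _ => rfl) s
  refine ⟨_, inferInstance, B, none, ?_, ?_⟩
  · rintro (_ | ⟨x, s⟩)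
    · exact hπ
    · exact hout x s
  · ext1 w
    rcases w with _ | ⟨x, w⟩
    · rfl
    · rw [wreath_cons, ← hq, ← hB]
      rfl

end wreath

/-- A group is generated by a finite `p`-automaton as soon as it acts faithfully on words in such
a way that the members of a finite generating family are finite-state. -/
theorem isGeneratedByFinitePAutomaton_of_injective {p : ℕ} {X J G : Type} [Group G] [Finite J]
    [Nonempty J] {c : Equiv.Perm X} (hX : Nat.card X = p) (hc : c.IsCycle) (hcp : orderOf c = p)
    (ψ : G →* Equiv.Perm (List X)) (hψ : Function.Injective ψ) (x : J → G)
    (hx : Subgroup.closure (Set.range x) = ⊤) (hfs : ∀ j, IsFiniteState c (ψ (x j))) :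
    IsGeneratedByFinitePAutomaton p G := by
  choose Q hQ A q hout hq using hfs
  let B : PermAutomaton (Σ j, Q j) X :=
    { next := fun s y => ⟨s.1, (A s.1).next s.2 y⟩
      out := fun s => (A s.1).out s.2 }
  have hB : ∀ j (s : Q j), B.wordPerm ⟨j, s⟩ = (A j).wordPerm s := fun j s =>
    PermAutomaton.wordPerm_map (A j) B (fun s => ⟨j, s⟩) (fun _ => rfl) (fun _ _ => rfl) s
  have hS : B.groupOf (Set.range fun j => ⟨j, q j⟩) = ψ.range := by
    rw [PermAutomaton.groupOf, MonoidHom.range_eq_map, ← hx, MonoidHom.map_closure,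
      ← Set.range_comp, ← Set.range_comp]
    congr 2
    funext j
    exact (hB j (q j)).trans (hq j)
  obtain ⟨j₀⟩ := ‹Nonempty J›
  refine ⟨_, X, B, Set.range fun j => ⟨j, q j⟩, inferInstance, ⟨⟨j₀, q j₀⟩⟩,
    ⟨hX, c, hc, hcp, fun s => hout s.1 s.2⟩, ⟨?_⟩⟩
  exact (MonoidHom.ofInjective hψ).trans (MulEquiv.subgroupCongr hS.symm)

/-! ### Groups generated by `p`-automata are residually `p`-finite -/

/-- The permutations of words that preserve lengths and prefixes and that permute the letters
below every word by a power of `c`. -/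
def treeAut {X : Type*} (c : Equiv.Perm X) : Subgroup (Equiv.Perm (List X)) where
  carrier := {g | (∀ w, (g w).length = w.length) ∧
    ∀ w, ∃ π ∈ Subgroup.zpowers c, ∀ x, g (w ++ [x]) = g w ++ [π x]}
  one_mem' := ⟨fun _ => rfl, fun w => ⟨1, one_mem _, fun _ => rfl⟩⟩
  mul_mem' := by
    rintro g h ⟨hg, hg'⟩ ⟨hh, hh'⟩
    refine ⟨fun w => (hg _).trans (hh w), fun w => ?_⟩
    obtain ⟨π, hπ, e⟩ := hh' w
    obtain ⟨π', hπ', e'⟩ := hg' (h w)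
    exact ⟨π' * π, mul_mem hπ' hπ, fun x => by simp [e, e']⟩
  inv_mem' := by
    rintro g ⟨hg, hg'⟩
    refine ⟨fun w => by simpa using (hg (g⁻¹ w)).symm, fun w => ?_⟩
    obtain ⟨π, hπ, e⟩ := hg' (g⁻¹ w)
    refine ⟨π⁻¹, inv_mem hπ, fun x => ?_⟩
    rw [Equiv.Perm.inv_eq_iff_eq, e]
    simp

theorem PermAutomaton.wordPerm_mem_treeAut {X Q : Type*} {c : Equiv.Perm X} (A : PermAutomaton Q X)
    (hout : ∀ q, A.out q ∈ Subgroup.zpowers c) (q : Q) : A.wordPerm q ∈ treeAut c := by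
  refine ⟨fun w => ?_, fun w => ?_⟩
  · change (A.act q w).length = _
    induction w generalizing q with
    | nil => rfl
    | cons x w ih => simp [act, ih]
  · change ∃ π ∈ Subgroup.zpowers c, ∀ x, A.act q (w ++ [x]) = A.act q w ++ [π x]
    induction w generalizing q with
    | nil => exact ⟨A.out q, hout q, fun x => rfl⟩
    | cons y w ih =>
      obtain ⟨π, hπ, e⟩ := ih (A.next q y)
      exact ⟨π, hπ, fun x => by simp [act, e]⟩

/-- On words of length `n`, every element of `treeAut c` has order dividing `p ^ n`: if it is
trivial on one level, then it acts on each set of children on the next one by a power of `c`. -/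
theorem pow_apply_of_mem_treeAut {X : Type*} {c : Equiv.Perm X} {p : ℕ} (hc : c ^ p = 1)
    {g : Equiv.Perm (List X)} (hg : g ∈ treeAut c) {n : ℕ} {w : List X} (hw : w.length = n) :
    (g ^ p ^ n) w = w := by
  induction n generalizing w with
  | zero =>
    obtain rfl := List.length_eq_zero_iff.1 hw
    simpa using List.length_eq_zero_iff.1 (hg.1 [])
  | succ n ih =>
    obtain ⟨u, x, rfl⟩ : ∃ u x, w = u ++ [x] := by
      rcases List.eq_nil_or_concat w with rfl | ⟨u, x, rfl⟩
      · simp at hw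
      · exact ⟨u, x, List.concat_eq_append⟩
    have hu : u.length = n := by simpa using hw
    obtain ⟨π, ⟨k, rfl⟩, e⟩ := ((treeAut c).pow_mem hg (p ^ n)).2 u
    have key : ∀ j : ℕ, ((g ^ p ^ n) ^ j) (u ++ [x]) = u ++ [((c ^ k) ^ j) x] := by
      intro j
      induction j with
      | zero => rfl
      | succ j ihj =>
        rw [pow_succ', Equiv.Perm.mul_apply, ihj, e, ih hu, pow_succ', Equiv.Perm.mul_apply]
    rw [pow_succ, pow_mul, key, ← zpow_natCast (c ^ k), zpow_comm, zpow_natCast, hc]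
    simp

/-- The action of `treeAut c` on the words of length `n`. -/
def levelHom {X : Type*} (c : Equiv.Perm X) (n : ℕ) :
    treeAut c →* Equiv.Perm {w : List X // w.length = n} where
  toFun g := (g : Equiv.Perm (List X)).subtypePerm fun w => by rw [g.2.1]
  map_one' := rfl
  map_mul' _ _ := rfl

theorem IsGeneratedByFinitePAutomaton.isResiduallyPFinite {p : ℕ} (hp : p.Prime) {G : Type*}
    [Group G] (h : IsGeneratedByFinitePAutomaton p G) : IsResiduallyPFinite p G := by
  obtain ⟨Q, X, A, S, _, _, ⟨hX, c, -, hcp, hout⟩, ⟨e⟩⟩ := h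
  have : Finite X := Nat.finite_of_card_ne_zero (hX ▸ hp.ne_zero)
  have hle : A.groupOf S ≤ treeAut c := by
    rw [PermAutomaton.groupOf, Subgroup.closure_le]
    rintro _ ⟨q, -, rfl⟩
    exact A.wordPerm_mem_treeAut hout q
  intro g hg
  obtain ⟨w, hw⟩ : ∃ w, (e g : Equiv.Perm (List X)) w ≠ w := by
    by_contra! hcon
    exact hg (e.injective (Subtype.ext (Equiv.ext fun w => by simpa using hcon w)))
  let f : G →* Equiv.Perm {u : List X // u.length = w.length} :=
    (levelHom c w.length).comp ((Subgroup.inclusion hle).comp e.toMonoidHom)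
  have hf : ∀ (x : G) u, (f x u : List X) = (e x : Equiv.Perm (List X)) u := fun _ _ => rfl
  have : Finite {u : List X // u.length = w.length} := List.finite_length_eq X w.length
  refine ⟨f.ker, inferInstance, fun hker => ?_, ?_, fun x => ?_⟩
  · exact hw (by rw [← hf g ⟨w, rfl⟩, MonoidHom.mem_ker.1 hker]; rfl)
  · exact Finite.of_equiv _ (QuotientGroup.quotientKerEquivRange f).symm.toEquiv
  · obtain ⟨x, rfl⟩ := QuotientGroup.mk_surjective x
    refine ⟨w.length, ?_⟩
    rw [← QuotientGroup.mk_pow, QuotientGroup.eq_one_iff, MonoidHom.mem_ker]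
    ext1 u
    refine Subtype.ext ?_
    rw [hf, map_pow]
    exact pow_apply_of_mem_treeAut (hcp ▸ pow_orderOf_eq_one c) (hle (e x).2) u.2

/-! ### Adding one on `ZMod p` -/

/-- The cycle `x ↦ x + 1` on `ZMod p`. -/
def addOne (p : ℕ) : Equiv.Perm (ZMod p) := Equiv.addRight 1

theorem addOne_pow (p n : ℕ) : addOne p ^ n = Equiv.addRight (n : ZMod p) := by
  induction n with
  | zero => ext x; simp
  | succ n ih =>
    ext1 x
    rw [pow_succ', Equiv.Perm.mul_apply, ih]
    simp [addOne, add_assoc]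

theorem addRight_mem_zpowers {p : ℕ} [NeZero p] (b : ZMod p) :
    Equiv.addRight b ∈ Subgroup.zpowers (addOne p) :=
  ⟨(b.val : ℤ), by
    change addOne p ^ ((b.val : ℕ) : ℤ) = _
    rw [zpow_natCast, addOne_pow, ZMod.natCast_zmod_val]⟩

theorem isCycle_addOne (p : ℕ) [Fact p.Prime] : (addOne p).IsCycle := by
  refine ⟨0, by simp [addOne], fun y _ => ⟨(y.val : ℤ), ?_⟩⟩
  rw [zpow_natCast, addOne_pow, ZMod.natCast_zmod_val]
  simp

theorem orderOf_addOne (p : ℕ) [Fact p.Prime] : orderOf (addOne p) = p := by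
  refine orderOf_eq_prime ?_ fun h => ?_
  · rw [addOne_pow]
    ext x
    simp
  · simpa [addOne] using Equiv.congr_fun h 0

/-! ### Affine maps of `ℤ_p ^ (r + 1)` as finite-state permutations -/

section affine

variable {p r : ℕ}

/-- The representatives in `{0, …, p - 1}` of a vector of residues. -/
def digitLift (d : Fin (r + 1) → ZMod p) : Fin (r + 1) → ℤ := fun j => ((d j).val : ℤ)

/-- The carry of the affine map `y ↦ y B + b` at the vector `d` of lowest digits: the translation
part of the map induced on the higher digits. -/
def carry (B : Matrix (Fin (r + 1)) (Fin (r + 1)) ℤ) (b : Fin (r + 1) → ℤ)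
    (d : Fin (r + 1) → ZMod p) : Fin (r + 1) → ℤ :=
  fun j => ((digitLift d ᵥ* B) j + b j) / p

variable (p r) in
/-- The automaton of affine maps. A word over `ZMod p` lists the digits of a vector
`y` of `p`-adic integers: first the lowest digits of all `r + 1` coordinates, then the next ones,
and so on. The state `(B, b, i, d)` stands for the map `y ↦ y B + b`, where `B` is congruent to
the identity modulo `p`, after the digits `d j` with `j < i` of the current block have been read;
the other values of `d` are irrelevant. -/
def affineAutomaton : PermAutomaton (Matrix (Fin (r + 1)) (Fin (r + 1)) ℤ × (Fin (r + 1) → ℤ) ×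
    Fin (r + 1) × (Fin (r + 1) → ZMod p)) (ZMod p) where
  next := fun (B, b, i, d) x =>
    if i = Fin.last r then (B, carry B b (Function.update d i x), 0, 0)
    else (B, b, i + 1, Function.update d i x)
  out := fun (_, b, i, _) => Equiv.addRight (b i : ZMod p)

variable (p) in
/-- The permutation of words defined by the affine map `y ↦ y B + b`. -/
def affinePerm (B : Matrix (Fin (r + 1)) (Fin (r + 1)) ℤ) (b : Fin (r + 1) → ℤ) :
    Equiv.Perm (List (ZMod p)) :=
  (affineAutomaton p r).wordPerm (B, b, 0, 0)

theorem intCast_vecMul_one_add_smul (N : Matrix (Fin (r + 1)) (Fin (r + 1)) ℤ)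
    (v : Fin (r + 1) → ℤ) (j : Fin (r + 1)) :
    (((v ᵥ* (1 + (p : ℤ) • N)) j : ℤ) : ZMod p) = v j := by
  rw [Matrix.vecMul_add, Matrix.vecMul_one, Matrix.vecMul_smul]
  simp [-zsmul_eq_mul]

/-- Carries satisfy the cocycle identity: the map that the composite of `y ↦ y B' + b'` and
`y ↦ y B + b` induces on the higher digits is the composite of the maps that they induce, the second
one at the digits produced by the first. -/
theorem carry_mul [NeZero p] {B B' : Matrix (Fin (r + 1)) (Fin (r + 1)) ℤ}
    (hB' : ∀ v j, (((v ᵥ* B') j : ℤ) : ZMod p) = v j) (b b' : Fin (r + 1) → ℤ)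
    (d : Fin (r + 1) → ZMod p) :
    carry (B' * B) (b' ᵥ* B + b) d =
      carry B' b' d ᵥ* B + carry B b (fun j => d j + (b' j : ZMod p)) := by
  have hz : digitLift d ᵥ* B' + b' =
      digitLift (fun j => d j + (b' j : ZMod p)) + (p : ℤ) • carry B' b' d := by
    ext j
    have h1 : d j + (b' j : ZMod p) = (((digitLift d ᵥ* B') j + b' j : ℤ) : ZMod p) := by
      rw [Int.cast_add, hB']
      simp [digitLift]
    have h2 := Int.emod_add_mul_ediv ((digitLift d ᵥ* B') j + b' j) p
    rw [← ZMod.val_intCast, ← h1] at h2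
    exact h2.symm
  ext j
  have h3 : (digitLift d ᵥ* (B' * B)) j + (b' ᵥ* B + b) j =
      ((digitLift (fun j => d j + (b' j : ZMod p)) ᵥ* B) j + b j) +
        p * (carry B' b' d ᵥ* B) j := by
    have h4 := congrFun (congrArg (· ᵥ* B) hz) j
    simp only [Matrix.add_vecMul, Matrix.vecMul_vecMul, Matrix.smul_vecMul, Pi.add_apply,
      Pi.smul_apply, smul_eq_mul] at h4
    simp only [Pi.add_apply]
    linarith
  have hp : (p : ℤ) ≠ 0 := by exact_mod_cast NeZero.ne p
  change (_ + _) / (p : ℤ) = _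
  rw [h3, Int.add_mul_ediv_left _ _ hp, add_comm]
  rfl

/-- States of the automaton compose like the affine maps they stand for, if the digits `e` read by
the second state are those written by the first one. -/
theorem affineAutomaton_act_mul [NeZero p] {B B' : Matrix (Fin (r + 1)) (Fin (r + 1)) ℤ}
    (hB : ∀ v j, (((v ᵥ* B) j : ℤ) : ZMod p) = v j)
    (hB' : ∀ v j, (((v ᵥ* B') j : ℤ) : ZMod p) = v j) (w : List (ZMod p))
    (b b' : Fin (r + 1) → ℤ) (i : Fin (r + 1)) (d e : Fin (r + 1) → ZMod p)
    (hde : ∀ j < i, e j = d j + (b' j : ZMod p)) :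
    (affineAutomaton p r).act (B' * B, b' ᵥ* B + b, i, d) w =
      (affineAutomaton p r).act (B, b, i, e) ((affineAutomaton p r).act (B', b', i, d) w) := by
  induction w generalizing b b' i d e with
  | nil => rfl
  | cons x w ih =>
    have hout : x + (((b' ᵥ* B + b) i : ℤ) : ZMod p) = x + (b' i : ZMod p) + (b i : ZMod p) := by
      simp [hB, add_assoc]
    have hupd : ∀ j ≤ i, Function.update e i (x + (b' i : ZMod p)) j =
        Function.update d i x j + (b' j : ZMod p) := by
      intro j hj
      rcases eq_or_ne j i with rfl | hne
      · simp
      · simp [hne, hde j (lt_of_le_of_ne hj hne)]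
    refine List.cons_eq_cons.2 ⟨hout, ?_⟩
    change (affineAutomaton p r).act (if _ then _ else _) w = (affineAutomaton p r).act
      (if _ then (B, carry B b (Function.update e i (x + (b' i : ZMod p))), 0, 0)
        else (B, b, i + 1, Function.update e i (x + (b' i : ZMod p))))
      ((affineAutomaton p r).act (if _ then _ else _) w)
    by_cases hi : i = Fin.last r
    · simp only [if_pos hi]
      have he : Function.update e i (x + (b' i : ZMod p)) =
          fun j => Function.update d i x j + (b' j : ZMod p) :=
        funext fun j => hupd j (hi ▸ Fin.le_last j)
      rw [carry_mul hB', he]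
      exact ih _ _ _ _ _ fun j hj => absurd hj (Fin.not_lt_zero j)
    · simp only [if_neg hi]
      refine ih _ _ _ _ _ fun j hj => hupd j ?_
      have := Fin.val_add_one_of_lt (Fin.lt_last_iff_ne_last.2 hi)
      rw [Fin.lt_def, this] at hj
      exact Fin.le_def.2 (by omega)

theorem affinePerm_mul [NeZero p] {B B' : Matrix (Fin (r + 1)) (Fin (r + 1)) ℤ}
    (hB : ∀ v j, (((v ᵥ* B) j : ℤ) : ZMod p) = v j)
    (hB' : ∀ v j, (((v ᵥ* B') j : ℤ) : ZMod p) = v j) (b b' : Fin (r + 1) → ℤ) :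
    affinePerm p B b * affinePerm p B' b' = affinePerm p (B' * B) (b' ᵥ* B + b) :=
  Equiv.ext fun w => (affineAutomaton_act_mul hB hB' w b b' 0 0 0
    fun j hj => absurd hj (Fin.not_lt_zero j)).symm

theorem abs_digitLift_vecMul_le [NeZero p] (B : Matrix (Fin (r + 1)) (Fin (r + 1)) ℤ)
    (d : Fin (r + 1) → ZMod p) (j : Fin (r + 1)) :
    |(digitLift d ᵥ* B) j| ≤ p * ∑ j, ∑ i, |B i j| := by
  have h : (digitLift d ᵥ* B) j = ∑ i, digitLift d i * B i j := rfl
  rw [h]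
  calc |∑ i, digitLift d i * B i j|
      ≤ ∑ i, |digitLift d i * B i j| := Finset.abs_sum_le_sum_abs _ _
    _ ≤ ∑ i, p * |B i j| := by
        refine Finset.sum_le_sum fun i _ => ?_
        rw [abs_mul]
        refine mul_le_mul_of_nonneg_right ?_ (abs_nonneg _)
        rw [digitLift, Nat.abs_cast]
        exact_mod_cast (ZMod.val_lt _).le
    _ = p * ∑ i, |B i j| := by rw [Finset.mul_sum]
    _ ≤ p * ∑ j, ∑ i, |B i j| := mul_le_mul_of_nonneg_left
        (Finset.single_le_sum (f := fun j => ∑ i, |B i j|)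
          (fun _ _ => Finset.sum_nonneg fun _ _ => abs_nonneg _) (Finset.mem_univ j))
        (Int.natCast_nonneg p)

/-- Only finitely many states are reachable from an affine map: the linear part never changes, and
division by `p` keeps the translation part bounded. -/
theorem isFiniteState_affinePerm [Fact p.Prime] (B : Matrix (Fin (r + 1)) (Fin (r + 1)) ℤ)
    (b : Fin (r + 1) → ℤ) : IsFiniteState (addOne p) (affinePerm p B b) := by
  have hp2 : (2 : ℤ) ≤ p := by exact_mod_cast (Fact.out : p.Prime).two_le
  obtain ⟨E, hE⟩ : ∃ E : ℤ, E = p * ∑ j, ∑ i, |B i j| := ⟨_, rfl⟩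
  have hE0 : 0 ≤ E := (abs_nonneg _).trans (hE ▸ abs_digitLift_vecMul_le B (0 : Fin (r + 1) → ZMod p) 0)
  -- The interval `[-K, K]` is mapped into itself by `y ↦ (e + y) / p` when `|e| ≤ E ≤ K`.
  obtain ⟨K, hK, hEK⟩ : ∃ K : ℤ, (∀ j, |b j| ≤ K) ∧ E ≤ K :=
    ⟨∑ j, |b j| + E, fun j => (Finset.single_le_sum (f := fun j => |b j|)
      (fun _ _ => abs_nonneg _) (Finset.mem_univ j)).trans (by omega),
      le_add_of_nonneg_left (Finset.sum_nonneg fun _ _ => abs_nonneg _)⟩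
  refine isFiniteState_of_closed _
    ({B} ×ˢ Set.Icc (fun _ => -K) (fun _ => K) ×ˢ Set.univ ×ˢ Set.univ) ?_ ?_
    (fun q => addRight_mem_zpowers _) ?_
  · exact (Set.finite_singleton B).prod
      ((Set.finite_Icc _ _).prod (Set.finite_univ.prod Set.finite_univ))
  · rintro ⟨B', b', i, d⟩ ⟨hBB, hb', -⟩ x
    obtain rfl : B' = B := hBB
    change (if _ then _ else _) ∈ _
    split_ifs with hi
    · refine ⟨rfl, ?_, trivial, trivial⟩
      have hdig := abs_digitLift_vecMul_le B' (Function.update d i x)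
      rw [← hE] at hdig
      refine ⟨fun j => ?_, fun j => ?_⟩
      · have h1 := (abs_le.1 (hdig j)).1
        have h2 : -K ≤ b' j := hb'.1 j
        refine (Int.le_ediv_iff_mul_le (by omega)).2 ?_
        nlinarith
      · have h1 := (abs_le.1 (hdig j)).2
        have h2 : b' j ≤ K := hb'.2 j
        refine Int.le_of_lt_add_one ((Int.ediv_lt_iff_lt_mul (by omega)).2 ?_)
        nlinarith
    · exact ⟨rfl, hb', trivial, trivial⟩
  · refine ⟨rfl, ?_, trivial, trivial⟩
    exact ⟨fun j => (abs_le.1 (hK j)).1, fun j => (abs_le.1 (hK j)).2⟩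

/-- If a translation is trivial on words, then it is trivial modulo `p`, and its carry at the zero
vector is trivial on words as well. The statement about a state within a block is what makes the
induction work. -/
theorem affineAutomaton_trivial (B : Matrix (Fin (r + 1)) (Fin (r + 1)) ℤ)
    (b : Fin (r + 1) → ℤ) (i : Fin (r + 1))
    (h : ∀ w, (affineAutomaton p r).act (B, b, i, 0) w = w) :
    (∀ j, i ≤ j → (p : ℤ) ∣ b j) ∧ affinePerm p B (carry B b (0 : Fin (r + 1) → ZMod p)) = 1 := by
  have h0 : ∀ i : Fin (r + 1), Function.update (0 : Fin (r + 1) → ZMod p) i 0 = 0 :=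
    fun i => Function.update_eq_self i 0
  have hdvd : ∀ i, (∀ w, (affineAutomaton p r).act (B, b, i, 0) w = w) → (p : ℤ) ∣ b i := by
    intro i hi
    have := (List.cons.inj (hi [0])).1
    rw [← ZMod.intCast_zmod_eq_zero_iff_dvd]
    simpa [affineAutomaton] using this
  induction i using Fin.reverseInduction with
  | last =>
    refine ⟨fun j hj => ?_, Equiv.ext fun w => ?_⟩
    · rw [Fin.last_le_iff.1 hj]
      exact hdvd _ h
    · have := (List.cons.inj (h (0 :: w))).2
      change (affineAutomaton p r).act (if _ then _ else _) w = w at this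
      rwa [if_pos rfl, h0] at this
  | cast i ih =>
    have hstep : ∀ w, (affineAutomaton p r).act (B, b, i.succ, 0) w = w := by
      intro w
      have := (List.cons.inj (h (0 :: w))).2
      simpa [affineAutomaton, h0, Fin.coeSucc_eq_succ, (Fin.castSucc_lt_last i).ne] using this
    obtain ⟨h1, h2⟩ := ih hstep
    refine ⟨fun j hj => ?_, h2⟩
    rcases eq_or_lt_of_le hj with rfl | hlt
    · exact hdvd _ h
    · exact h1 j (Fin.castSucc_lt_iff_succ_le.1 hlt)

/-- Distinct translations differ on words: a trivial one is divisible by every power of `p`. -/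
theorem eq_zero_of_affinePerm_one_eq_one [Fact p.Prime] {v : Fin (r + 1) → ℤ}
    (h : affinePerm p 1 v = 1) : v = 0 := by
  have key : ∀ (k : ℕ) (v : Fin (r + 1) → ℤ), affinePerm p 1 v = 1 → ∀ j, (p : ℤ) ^ k ∣ v j := by
    intro k
    induction k with
    | zero => simp
    | succ k ih =>
      intro v hv j
      obtain ⟨h1, h2⟩ := affineAutomaton_trivial 1 v 0 fun w => Equiv.congr_fun hv w
      have h3 := ih _ h2 j
      have h4 : carry 1 v (0 : Fin (r + 1) → ZMod p) j = v j / p := by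
        simp [carry, digitLift]
      rw [h4] at h3
      obtain ⟨u, hu⟩ := h1 j (Fin.zero_le j)
      have hp0 : (p : ℤ) ≠ 0 := by exact_mod_cast (Fact.out : p.Prime).ne_zero
      rw [hu, Int.mul_ediv_cancel_left _ hp0] at h3
      rw [hu, pow_succ']
      exact mul_dvd_mul_left _ h3
  ext j
  refine Int.natAbs_eq_zero.1 (Nat.eq_zero_of_dvd_of_lt (a := p ^ (v j).natAbs)
    ?_ (Nat.lt_pow_self (Fact.out : p.Prime).one_lt))
  simpa [Int.natAbs_pow] using Int.natAbs_dvd_natAbs.2 (key (v j).natAbs v h j)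

variable (p r) in
/-- Translations of `ℤ_p ^ (r + 1)` by integer vectors, as permutations of words. -/
def translationHom [Fact p.Prime] :
    Multiplicative (Fin (r + 1) → ℤ) →* Equiv.Perm (List (ZMod p)) :=
  MonoidHom.mk' (fun v => affinePerm p 1 v.toAdd) fun v w => by
    rw [affinePerm_mul (by simp) (by simp)]
    simp [add_comm]

end affine

/-! ### Realizations by finite-state permutations -/

/-- The integer matrix `M` is realized by finite-state permutations of words over `ZMod p`: there
are an action `α` of the lattice `ℤ ^ r` and a permutation `s`, all finite-state, such that
`s` conjugates `α v` to `α (v M)` and `α v * s ^ n` is non-trivial unless `v = 0` and `n = 0`. The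
permutation `s` is to be the image of the generator `t⁻¹` of `HNNGroup M`. -/
def IsRealizable (p : ℕ) {r : ℕ} (M : Matrix (Fin r) (Fin r) ℤ) : Prop :=
  ∃ (α : Multiplicative (Fin r → ℤ) →* Equiv.Perm (List (ZMod p)))
    (s : Equiv.Perm (List (ZMod p))),
    (∀ v, IsFiniteState (addOne p) (α v)) ∧ IsFiniteState (addOne p) s ∧
    (∀ v : Fin r → ℤ, s * α (.ofAdd v) = α (.ofAdd (v ᵥ* M)) * s) ∧
    ∀ (v : Fin r → ℤ) (n : ℤ), α (.ofAdd v) * s ^ n = 1 → v = 0 ∧ n = 0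

/-- A matrix congruent to the identity is realized by affine maps of `ℤ_p ^ (r + 1)`. As `M` may
have finite order, the linear map alone does not do for `s`. The affine maps therefore act below the
first letter `0` only, and below the other letters `s` acts as a translation of `ℤ_p`, which has
infinite order. -/
theorem isRealizable_one_add_smul {p r : ℕ} [Fact p.Prime]
    (N : Matrix (Fin (r + 1)) (Fin (r + 1)) ℤ) : IsRealizable p (1 + (p : ℤ) • N) := by
  set M := 1 + (p : ℤ) • N with hM
  have hMp : ∀ v j, (((v ᵥ* M) j : ℤ) : ZMod p) = v j := intCast_vecMul_one_add_smul N
  have h1p : ∀ (v : Fin (r + 1) → ℤ) j,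
      (((v ᵥ* (1 : Matrix (Fin (r + 1)) (Fin (r + 1)) ℤ)) j : ℤ) : ZMod p) = v j := by simp
  let α := translationHom p r
  let ω : Equiv.Perm (List (ZMod p)) := translationHom p 0 (.ofAdd fun _ => 1)
  have hω : ∀ n : ℤ, ω ^ n = 1 → n = 0 := by
    intro n hn
    rw [← map_zpow] at hn
    simpa using congrFun (eq_zero_of_affinePerm_one_eq_one (r := 0) hn) 0
  have h10 : (1 : ZMod p) ≠ 0 := one_ne_zero
  let α' : Multiplicative (Fin (r + 1) → ℤ) →* Equiv.Perm (List (ZMod p)) :=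
    (wreathHom (ZMod p)).comp ((MonoidHom.mulSingle _ 0).comp α)
  let s' : ZMod p → Equiv.Perm (List (ZMod p)) :=
    fun x => if x = 0 then affinePerm p M 0 else ω
  have key : ∀ v : Fin (r + 1) → ℤ,
      affinePerm p M 0 * α (.ofAdd v) = α (.ofAdd (v ᵥ* M)) * affinePerm p M 0 := by
    intro v
    change affinePerm p M 0 * affinePerm p 1 v = affinePerm p 1 (v ᵥ* M) * affinePerm p M 0
    rw [affinePerm_mul hMp h1p, affinePerm_mul h1p hMp]
    simp
  refine ⟨α', wreathHom _ s', fun v => ?_, ?_, fun v => ?_, fun v n h => ?_⟩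
  · refine isFiniteState_wreath (one_mem _) fun x => ?_
    rcases eq_or_ne x 0 with rfl | hx
    · simpa [α, translationHom] using isFiniteState_affinePerm 1 v.toAdd
    · simpa [hx] using isFiniteState_one _
  · refine isFiniteState_wreath (one_mem _) fun x => ?_
    rcases eq_or_ne x 0 with rfl | hx
    · simpa [s'] using isFiniteState_affinePerm _ _
    · simpa [s', hx, ω, translationHom] using isFiniteState_affinePerm _ _
  · change wreathHom _ s' * wreathHom _ _ = wreathHom _ _ * wreathHom _ s'
    rw [← map_mul, ← map_mul]
    congr 1
    ext1 x
    rcases eq_or_ne x 0 with rfl | hx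
    · simpa [s'] using key v
    · simp [s', hx]
  · change wreathHom _ (Pi.mulSingle 0 (α (.ofAdd v))) * wreathHom _ s' ^ n = 1 at h
    rw [← map_zpow, ← map_mul] at h
    have h2 := (eq_one_of_wreath_eq_one h).2
    have hn : n = 0 := hω n (by simpa [s', h10] using h2 1)
    subst hn
    exact ⟨eq_zero_of_affinePerm_one_eq_one (p := p) (by simpa [α, translationHom] using h2 0), rfl⟩

/-- The action of `HNNGroup (M ^ p)` on words induces an action of `HNNGroup M`, which contains it
with index `p`: the first letter is the coset of a power of `t`. -/
theorem IsRealizable.of_pow {p r : ℕ} [Fact p.Prime] {M : Matrix (Fin r) (Fin r) ℤ}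
    (h : IsRealizable p (M ^ p)) : IsRealizable p M := by
  obtain ⟨α, s, hα, hs, hcomm, hfaith⟩ := h
  have hp1 : 1 < p := (Fact.out : p.Prime).one_lt
  let A : (Fin r → ℤ) → ZMod p → Equiv.Perm (List (ZMod p)) :=
    fun v x => α (.ofAdd (v ᵥ* M ^ x.val))
  let α' : Multiplicative (Fin r → ℤ) →* Equiv.Perm (List (ZMod p)) :=
    MonoidHom.mk' (fun v => wreath 1 (A v.toAdd)) fun v w => by
      rw [wreath_mul]
      congr 1
      ext1 x
      simp only [A, toAdd_mul, Matrix.add_vecMul, ofAdd_add, map_mul]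
      rfl
  let s' : Equiv.Perm (List (ZMod p)) := wreath (addOne p)⁻¹ fun x => if x = 0 then s else 1
  have hinv : ∀ x, (addOne p)⁻¹ x = x - 1 := fun x => (sub_eq_add_neg x 1).symm
  -- A full turn of the first letter passes through `0` once.
  have hpow : ∀ k ≤ p, s' ^ k = wreath ((addOne p)⁻¹ ^ k) fun x => if x.val < k then s else 1 := by
    intro k hk
    induction k with
    | zero => simpa using wreath_one.symm
    | succ k ih =>
      rw [pow_succ', ih (by omega), wreath_mul, ← pow_succ']
      congr 1
      ext1 x
      have hx : ((addOne p)⁻¹ ^ k) x = x - k := by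
        rw [inv_pow, addOne_pow]
        exact (sub_eq_add_neg x (k : ZMod p)).symm
      have hiff : x - k = 0 ↔ x.val = k := by
        rw [sub_eq_zero]
        constructor
        · rintro rfl
          exact ZMod.val_cast_of_lt (by omega)
        · rintro rfl
          exact (ZMod.natCast_zmod_val x).symm
      rw [hx]
      rcases lt_trichotomy x.val k with hlt | heq | hgt
      · simp [hiff, hlt, hlt.ne, Nat.lt_succ_of_lt hlt]
      · simp [hiff, heq]
      · simp [hiff, hgt.not_gt, hgt.ne', show ¬ x.val < k + 1 by omega]
  have hturn : s' ^ p = wreathHom _ fun _ => s := by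
    have h1 : addOne p ^ p = 1 := orderOf_dvd_iff_pow_eq_one.1 (orderOf_addOne p).dvd
    rw [hpow p le_rfl, inv_pow, h1, inv_one]
    simp [ZMod.val_lt, wreathHom]
  refine ⟨α', s', fun v => isFiniteState_wreath (one_mem _) fun x => hα _, ?_, fun v => ?_,
    fun v n h => ?_⟩
  · refine isFiniteState_wreath (inv_mem (Subgroup.mem_zpowers _)) fun x => ?_
    split_ifs
    exacts [hs, isFiniteState_one _]
  · change wreath _ _ * wreath 1 (A v) = wreath 1 (A (v ᵥ* M)) * wreath _ _
    rw [wreath_mul, wreath_mul, mul_one, one_mul]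
    congr 1
    ext1 x
    simp only [A, Matrix.vecMul_vecMul, ← pow_succ', hinv, Equiv.Perm.one_apply]
    rcases eq_or_ne x 0 with rfl | hx
    · have h0 : (0 - 1 : ZMod p).val + 1 = p := by
        rw [zero_sub, ZMod.val_neg_of_ne_zero, ZMod.val_one, Nat.sub_add_cancel hp1.le]
      simpa only [h0, if_true, ZMod.val_zero, pow_zero, Matrix.vecMul_one, mul_one] using hcomm v
    · have h0 : (x - 1).val + 1 = x.val := by
        have h1 : 1 ≤ x.val := Nat.one_le_iff_ne_zero.2 ((ZMod.val_ne_zero x).2 hx)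
        rw [ZMod.val_sub (by rwa [ZMod.val_one]), ZMod.val_one, Nat.sub_add_cancel h1]
      simp [hx, h0]
  · change wreath 1 (A v) * s' ^ n = 1 at h
    obtain ⟨l, k, hk, rfl⟩ : ∃ (l : ℤ) (k : ℕ), k < p ∧ n = p * l + k := by
      refine ⟨n / p, (n % p).toNat, ?_, ?_⟩
      · have := Int.emod_lt_of_pos n (b := p) (by omega)
        omega
      · rw [Int.toNat_of_nonneg (Int.emod_nonneg n (by omega)), Int.mul_ediv_add_emod]
    rw [zpow_add, zpow_mul, zpow_natCast, zpow_natCast, hturn, ← map_zpow, hpow k hk.le] at h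
    change wreath 1 _ * (wreath 1 _ * wreath _ _) = 1 at h
    rw [wreath_mul, wreath_mul, one_mul, one_mul] at h
    obtain ⟨h1, h2⟩ := eq_one_of_wreath_eq_one h
    obtain rfl : k = 0 := by
      rw [inv_pow, inv_eq_one, ← orderOf_dvd_iff_pow_eq_one, orderOf_addOne] at h1
      exact Nat.eq_zero_of_dvd_of_lt h1 hk
    obtain ⟨h3, rfl⟩ := hfaith v l (by simpa [A] using h2 0)
    exact ⟨h3, by simp⟩

theorem isRealizable_of_pow_eq {p r m : ℕ} [Fact p.Prime]
    {M N : Matrix (Fin (r + 1)) (Fin (r + 1)) ℤ} (h : M ^ p ^ m = 1 + (p : ℤ) • N) :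
    IsRealizable p M := by
  induction m generalizing M with
  | zero =>
    rw [pow_zero, pow_one] at h
    exact h ▸ isRealizable_one_add_smul N
  | succ m ih => exact (ih (by rw [← pow_mul, ← pow_succ', h])).of_pow

/-! ### The groups `HNNGroup M` -/

/-- A homomorphism on `ℤ ^ r` is given by the ordered product of powers of its values on the
standard basis. -/
theorem prod_map_finRange_zpow {r : ℕ} {H : Type*} [Group H]
    (α : Multiplicative (Fin r → ℤ) →* H) (v : Fin r → ℤ) :
    ((List.finRange r).map fun j => α (.ofAdd (Pi.single j 1)) ^ v j).prod = α (.ofAdd v) := by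
  have h : ∀ j, α (.ofAdd (Pi.single j 1)) ^ v j = α (.ofAdd (Pi.single j (v j))) := fun j => by
    rw [← map_zpow, ← ofAdd_zsmul, ← Pi.single_smul]
    simp
  have h2 : v = ((List.finRange r).map fun j => (Pi.single j (v j) : Fin r → ℤ)).sum := by
    rw [← List.ofFn_eq_map, List.sum_ofFn, Finset.univ_sum_single]
  conv_rhs => rw [h2]
  rw [ofAdd_list_prod, map_list_prod, List.map_map, List.map_map]
  simp only [h, Function.comp_def]

theorem exists_hom_of_commute {r : ℕ} {H : Type*} [Group H] (x : Fin r → H)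
    (hx : ∀ i j, Commute (x i) (x j)) :
    ∃ α : Multiplicative (Fin r → ℤ) →* H, ∀ i, α (.ofAdd (Pi.single i 1)) = x i := by
  let f : (Fin r → Multiplicative ℤ) →* H :=
    MonoidHom.noncommPiCoprod (fun i => zpowersHom H (x i)) fun i j _ m n =>
      ((hx i j).zpow_zpow _ _)
  let e : Multiplicative (Fin r → ℤ) →* (Fin r → Multiplicative ℤ) :=
    MonoidHom.mk' (fun v i => .ofAdd (v.toAdd i)) fun _ _ => rfl
  refine ⟨f.comp e, fun i => ?_⟩
  have h : e (.ofAdd (Pi.single i 1)) = Pi.mulSingle i (.ofAdd 1) := by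
    ext1 j
    rcases eq_or_ne j i with rfl | hj
    · simp [e]
    · simp [e, hj]
  rw [MonoidHom.comp_apply, h]
  exact (MonoidHom.noncommPiCoprod_mulSingle _ i _).trans (by simp)

namespace HNNGroup

variable {r : ℕ} {M : Matrix (Fin r) (Fin r) ℤ}

/-- The image of `a_i` in `HNNGroup M`. -/
def base (M : Matrix (Fin r) (Fin r) ℤ) (i : Fin r) : HNNGroup M := PresentedGroup.of (Sum.inl i)

/-- The image of `t` in `HNNGroup M`. -/
def stable (M : Matrix (Fin r) (Fin r) ℤ) : HNNGroup M := PresentedGroup.of (Sum.inr ())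

theorem base_commute (i j : Fin r) : Commute (base M i) (base M j) := by
  have h : PresentedGroup.mk (relators M) (a i * a j * (a i)⁻¹ * (a j)⁻¹) = 1 :=
    PresentedGroup.one_of_mem (Or.inl ⟨i, j, rfl⟩)
  rw [map_mul, map_mul, map_mul, map_inv, map_inv, mul_inv_eq_one, mul_inv_eq_iff_eq_mul] at h
  exact h

theorem stable_inv_mul_base_mul_stable (i : Fin r) :
    (stable M)⁻¹ * base M i * stable M =
      ((List.finRange r).map fun j => base M j ^ M i j).prod := by
  have h : PresentedGroup.mk (relators M)
      ((t⁻¹ * a i * t) * (((List.finRange r).map fun j => a j ^ M i j).prod)⁻¹) = 1 :=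
    PresentedGroup.one_of_mem (Or.inr ⟨i, rfl⟩)
  rw [map_mul, map_inv, mul_inv_eq_one, map_list_prod, List.map_map] at h
  simp only [map_mul, map_inv, map_zpow, Function.comp_def] at h
  exact h

theorem closure_base_stable :
    Subgroup.closure (Set.range fun j : Option (Fin r) => j.elim (stable M)⁻¹ (base M)) = ⊤ := by
  rw [eq_top_iff, ← PresentedGroup.closure_range_of, Subgroup.closure_le]
  rintro _ ⟨i | i, rfl⟩
  · exact Subgroup.subset_closure ⟨some i, rfl⟩
  · exact inv_mem_iff.1 (Subgroup.subset_closure ⟨none, rfl⟩)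

/-- Every element is `t ^ i * u * t⁻¹ ^ j` with `i, j ≥ 0` and `u` in the base group. -/
theorem exists_normalForm (α : Multiplicative (Fin r → ℤ) →* HNNGroup M)
    (hα : ∀ i, α (.ofAdd (Pi.single i 1)) = base M i)
    (hcomm : ∀ v : Fin r → ℤ, (stable M)⁻¹ * α (.ofAdd v) = α (.ofAdd (v ᵥ* M)) * (stable M)⁻¹)
    (g : HNNGroup M) :
    ∃ (i : ℕ) (v : Fin r → ℤ) (j : ℕ),
      g = stable M ^ i * α (.ofAdd v) * (stable M)⁻¹ ^ j := by
  have hcomm' : ∀ (i : ℕ) (v : Fin r → ℤ),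
      α (.ofAdd v) * stable M ^ i = stable M ^ i * α (.ofAdd (v ᵥ* M ^ i)) := by
    intro i
    induction i with
    | zero => simp
    | succ i ih =>
      intro v
      have h : ∀ w : Fin r → ℤ,
          α (.ofAdd w) * stable M = stable M * α (.ofAdd (w ᵥ* M)) := fun w => by
        rw [← inv_mul_eq_iff_eq_mul, ← mul_assoc, hcomm, inv_mul_cancel_right]
      rw [pow_succ, ← mul_assoc, ih, mul_assoc, h, pow_succ, ← Matrix.vecMul_vecMul, mul_assoc]
  have hmem : g ∈ Subgroup.closure (Set.range (PresentedGroup.of (rels := relators M))) := by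
    rw [PresentedGroup.closure_range_of]
    trivial
  have hbase : ∀ (w : Fin r → ℤ) (x : HNNGroup M), (∃ (i : ℕ) (v : Fin r → ℤ) (j : ℕ),
      x = stable M ^ i * α (.ofAdd v) * (stable M)⁻¹ ^ j) → ∃ (i : ℕ) (v : Fin r → ℤ) (j : ℕ),
      α (.ofAdd w) * x = stable M ^ i * α (.ofAdd v) * (stable M)⁻¹ ^ j := by
    rintro w _ ⟨i, v, j, rfl⟩
    refine ⟨i, w ᵥ* M ^ i + v, j, ?_⟩
    rw [ofAdd_add, map_mul, ← mul_assoc, ← mul_assoc, ← mul_assoc, hcomm']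
  induction hmem using Subgroup.closure_induction_left with
  | one => exact ⟨0, 0, 0, by simp⟩
  | mul_left y hy x _ ih =>
    obtain ⟨i | i, rfl⟩ := hy
    · have := hbase (Pi.single i 1) x ih
      rwa [hα] at this
    · obtain ⟨i, v, j, rfl⟩ := ih
      refine ⟨i + 1, v, j, ?_⟩
      rw [pow_succ', ← mul_assoc, ← mul_assoc]
      rfl
  | inv_mul_cancel y hy x _ ih =>
    obtain ⟨i | i, rfl⟩ := hy
    · have := hbase (-Pi.single i 1) x ih
      rwa [ofAdd_neg, map_inv, hα] at this
    · obtain ⟨i, v, j, rfl⟩ := ih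
      change ∃ (i' : ℕ) (v' : Fin r → ℤ) (j' : ℕ), (stable M)⁻¹ * _ = _
      cases i with
      | zero =>
        refine ⟨0, v ᵥ* M, j + 1, ?_⟩
        rw [pow_zero, one_mul, one_mul, ← mul_assoc, hcomm, pow_succ', mul_assoc]
      | succ i =>
        refine ⟨i, v, j, ?_⟩
        rw [pow_succ', mul_assoc, mul_assoc, mul_assoc, inv_mul_cancel_left]

/-- A realization of `M` is a faithful action of `HNNGroup M`. -/
theorem isGeneratedByFinitePAutomaton {p : ℕ} [Fact p.Prime] (h : IsRealizable p M) :
    IsGeneratedByFinitePAutomaton p (HNNGroup M) := by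
  obtain ⟨α, s, hα, hs, hcomm, hfaith⟩ := h
  let f : Fin r ⊕ Unit → Equiv.Perm (List (ZMod p)) :=
    Sum.elim (fun i => α (.ofAdd (Pi.single i 1))) fun _ => s⁻¹
  have hfa : ∀ i, FreeGroup.lift f (a i) = α (.ofAdd (Pi.single i 1)) := fun i =>
    FreeGroup.lift_apply_of
  have hft : FreeGroup.lift f t = s⁻¹ := FreeGroup.lift_apply_of
  have hf : ∀ w ∈ relators M, FreeGroup.lift f w = 1 := by
    rintro _ (⟨i, j, rfl⟩ | ⟨i, rfl⟩)
    · simp only [map_mul, map_inv, hfa]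
      rw [mul_inv_eq_one, mul_inv_eq_iff_eq_mul]
      exact (Commute.all _ _).map α
    · rw [map_mul, map_inv, mul_inv_eq_one, map_list_prod, List.map_map]
      simp only [map_mul, map_inv, map_zpow, Function.comp_def, hfa, hft]
      rw [prod_map_finRange_zpow, inv_inv, hcomm, mul_inv_cancel_right, Matrix.single_one_vecMul]
      rfl
  let ψ : HNNGroup M →* Equiv.Perm (List (ZMod p)) := PresentedGroup.toGroup hf
  have hψa : ∀ i, ψ (base M i) = α (.ofAdd (Pi.single i 1)) := fun i => PresentedGroup.toGroup.of hf
  have hψt : ψ (stable M) = s⁻¹ := PresentedGroup.toGroup.of hf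
  obtain ⟨β, hβ⟩ := exists_hom_of_commute (base M) base_commute
  have hψβ : ∀ v : Fin r → ℤ, ψ (β (.ofAdd v)) = α (.ofAdd v) := fun v => by
    rw [← prod_map_finRange_zpow, ← prod_map_finRange_zpow, map_list_prod, List.map_map]
    simp only [Function.comp_def, map_zpow, hβ, hψa]
  have hβcomm : ∀ v : Fin r → ℤ,
      (stable M)⁻¹ * β (.ofAdd v) = β (.ofAdd (v ᵥ* M)) * (stable M)⁻¹ := by
    intro v
    let γ := (MulAut.conj (stable M)⁻¹).toMonoidHom.comp β
    let δ := β.comp (AddMonoidHom.toMultiplicative M.vecMulLinear.toAddMonoidHom)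
    have hγδ : ∀ i, γ (.ofAdd (Pi.single i 1)) = δ (.ofAdd (Pi.single i 1)) := by
      intro i
      have h1 : γ (.ofAdd (Pi.single i 1)) = (stable M)⁻¹ * base M i * stable M := by
        simp [γ, hβ]
      have h2 : δ (.ofAdd (Pi.single i 1)) = β (.ofAdd (M i)) :=
        congrArg (fun w => β (.ofAdd w)) (Matrix.single_one_vecMul i M)
      rw [h1, h2, stable_inv_mul_base_mul_stable, ← prod_map_finRange_zpow]
      simp only [hβ]
    have h3 : γ (.ofAdd v) = δ (.ofAdd v) := by
      rw [← prod_map_finRange_zpow, ← prod_map_finRange_zpow]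
      simp only [hγδ]
    rw [← mul_inv_eq_iff_eq_mul]
    exact h3
  refine isGeneratedByFinitePAutomaton_of_injective (Nat.card_zmod p) (isCycle_addOne p)
    (orderOf_addOne p) ψ ?_ _ closure_base_stable ?_
  · rw [injective_iff_map_eq_one]
    intro g hg
    obtain ⟨i, v, j, rfl⟩ := exists_normalForm β hβ hβcomm g
    have h1 : α (.ofAdd v) * s ^ ((j : ℤ) - i) = 1 := by
      simp only [map_mul, map_pow, map_inv, hψt, hψβ, inv_inv, inv_pow] at hg
      rw [mul_assoc, inv_mul_eq_one] at hg
      rw [zpow_sub, zpow_natCast, zpow_natCast, ← mul_assoc, ← hg, mul_inv_cancel]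
    obtain ⟨rfl, h2⟩ := hfaith v _ h1
    obtain rfl : j = i := by omega
    rw [ofAdd_zero, map_one, mul_one, inv_pow, mul_inv_cancel]
  · rintro (_ | i)
    · change IsFiniteState _ (ψ (stable M)⁻¹)
      rw [map_inv, hψt, inv_inv]
      exact hs
    · change IsFiniteState _ (ψ (base M i))
      rw [hψa]
      exact hα _

end HNNGroup

/-! ### The theorem for `M = p N + C` -/

/-- A matrix congruent modulo `p` to a permutation matrix of order `p ^ m` has a power congruent to
the identity. -/
theorem exists_pow_eq_one_add_smul {p r m : ℕ} (N : Matrix (Fin r) (Fin r) ℤ)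
    {σ : Equiv.Perm (Fin r)} (hσ : orderOf σ = p ^ m) :
    ∃ N' : Matrix (Fin r) (Fin r) ℤ,
      ((p : ℤ) • N + σ.permMatrix ℤ) ^ p ^ m = 1 + (p : ℤ) • N' := by
  let φ := (Int.castRingHom (ZMod p)).mapMatrix (m := Fin r)
  have hC : σ.permMatrix ℤ ^ p ^ m = 1 := by
    have h : Matrix.permMatrixHom (R := ℤ) σ⁻¹ ^ p ^ m = 1 := by
      rw [← map_pow, inv_pow, ← hσ, pow_orderOf_eq_one, inv_one, map_one]
    simpa using h
  have hφ : φ (((p : ℤ) • N + σ.permMatrix ℤ) ^ p ^ m) = φ 1 := by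
    have h : φ ((p : ℤ) • N) = 0 := by
      ext i j
      change (((p : ℤ) * N i j : ℤ) : ZMod p) = 0
      simp
    rw [map_pow, map_add, h, zero_add, ← map_pow, hC]
  have hdvd : ∀ i j, (p : ℤ) ∣ (((p : ℤ) • N + σ.permMatrix ℤ) ^ p ^ m - 1) i j := by
    intro i j
    rw [← ZMod.intCast_zmod_eq_zero_iff_dvd]
    have h : φ (((p : ℤ) • N + σ.permMatrix ℤ) ^ p ^ m - 1) = 0 := by rw [map_sub, hφ, sub_self]
    exact congrFun (congrFun h i) j
  choose N' hN' using hdvd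
  refine ⟨Matrix.of N', ?_⟩
  rw [← sub_eq_iff_eq_add']
  ext i j
  rw [hN']
  rfl

theorem mainTheorem1 (p : ℕ) (hp : p.Prime) (k : ℕ) (hk : 1 ≤ k) (r : ℕ) (hr : r = p ^ k)
    (N C M : Matrix (Fin r) (Fin r) ℤ) (σ : Equiv.Perm (Fin r)) (m : ℕ)
    (hσ : orderOf σ = p ^ m) (hC : C = σ.permMatrix ℤ) (hM : M = (p : ℤ) • N + C) :
    IsGeneratedByFinitePAutomaton p (HNNGroup M) ∧ IsResiduallyPFinite p (HNNGroup M) := by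
  have : Fact p.Prime := ⟨hp⟩
  have key : IsGeneratedByFinitePAutomaton p (HNNGroup M) := by
    obtain ⟨r, rfl⟩ : ∃ n, r = n + 1 :=
      Nat.exists_eq_succ_of_ne_zero (hr ▸ pow_ne_zero k hp.ne_zero)
    obtain ⟨N', hN'⟩ := exists_pow_eq_one_add_smul N hσ
    rw [← hC, ← hM] at hN'
    exact HNNGroup.isGeneratedByFinitePAutomaton (isRealizable_of_pow_eq hN')
  exact ⟨key, key.isResiduallyPFinite hp⟩
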